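/- Let $p\in\mathbb N$ and $r>0$, and let $\mathbb B^p_r=\{x\in\mathbb R^p:\|x\|_2\le r\}$. For a topological space $X$, let $\mathscr M_{\le 1}(X)$ and $\mathscr P(X)$ be the spaces of nonnegative Borel measures on $X$ of total mass at most one, respectively of Borel probability measures on $X$, each with the weak$^*$ topology, i.e. the topology generated by the maps $\mu\mapsto\int_X f\,d\mu$ for bounded continuous $f:X\to\mathbb R$. Define inductively $\mathcal M^0=\mathbb B^p_r$, and, for $t\ge 0$, $\mathcal H^t=\prod_{i\le t}\mathcal M^i$ with the product topology and $\mathcal M^{t+1}=\mathscr M_{\le1}(\mathcal H^t)$. Let $p_{t,t-1}:\mathcal H^t\to\mathcal H^{t-1}$ and $p_t:\mathcal H^t\to\mathcal M^t$ be the projections that drop, respectively select, the last entry. The elements of $\mathscr P(\mathcal H^L)$ are called distributions of iterated degree measures (DIDMs) of order $L$. An $L$-layer MPNN model is a sequence $\varphi=(\varphi^{(t)})_{t=0}^L$ of Lipschitz continuous functions $\varphi^{(0)}:\mathbb R^p\to\mathbb R^{d_0}$ and $\varphi^{(t)}:\mathbb R^{2d_{t-1}}\to\mathbb R^{d_t}$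 for $1\le t\le L$, where the dimensions $d_0,\dots,d_L\in\mathbb N$ are arbitrary; a readout function is a Lipschitz continuous $\psi:\mathbb R^{d_L}\to\mathbb R^d$. Put $\mathfrak h^{(0)}_\tau=\varphi^{(0)}(\tau)$ for $\tau\in\mathcal H^0=\mathbb B^p_r$ and $$\mathfrak h^{(t)}_\tau=\varphi^{(t)}\Big(\mathfrak h^{(t-1)}_{p_{t,t-1}(\tau)},\ \int_{\mathcal H^{t-1}}\mathfrak h^{(t-1)}_{-}\,d\,p_t(\tau)\Big)\quad(\tau\in\mathcal H^t,\ 1\le t\le L),\qquad \mathfrak H(\varphi,\psi,\nu)=\psi\Big(\int_{\mathcal H^L}\mathfrak h^{(L)}_{-}\,d\nu\Big)\quad(\nu\in\mathscr P(\mathcal H^L)).$$ \textbf{Corollary.} Let $L\in\mathbb N$ (with $L=0$ allowed) and let the integer $d>0$ be fixed. Let $\nu\in\mathscr P(\mathcal H^L)$ and let $(\nu_i)_i$ be a sequence in $\mathscr P(\mathcal H^L)$. Then $\nu_i\to\nu$ in the weak$^*$ topology if and only if $\mathfrak H(\varphi,\psi,\nu_i)\to\mathfrak H(\varphi,\psi,\nu)$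 in $\mathbb{R}^d$ for all $L$-layer MPNN models $\varphi$ and all readout functions $\psi:\mathbb R^{d_L}\to\mathbb R^d$. -/

import Mathlib

open MeasureTheory Filter Topology

noncomputable section

/-- `ℝ^n` with its Euclidean norm. -/
abbrev Eucl (n : ℕ) : Type := EuclideanSpace ℝ (Fin n)

/-- `ℳ_{≤ 1}(X)`: the nonnegative Borel measures of total mass at most one, with the
weak* topology (as a subspace of Mathlib's `FiniteMeasure X`, whose topology is generated by
integration against bounded continuous functions). -/
abbrev SubProbMeasure (X : Type) [TopologicalSpace X] [MeasurableSpace X] : Type :=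
  {μ : FiniteMeasure X // μ.mass ≤ 1}

/-- The topological space `ℋ^L = ∏_{i ≤ L} ℳ^i` of iterated degree measures of order `L`, where
`ℳ^0` is the closed ball of radius `r` in `ℝ^p` and `ℳ^{i+1} = ℳ_{≤ 1}(ℋ^i)` with the weak*
topology. The finite product is built one factor at a time: `ℋ^{L+1} = ℋ^L × ℳ^{L+1}`, with the
product topology; measures on `ℋ^L` are measures on its Borel σ-algebra. -/
def IDMTop (p : ℕ) (r : ℝ) : ℕ → TopCat.{0}
  | 0 => TopCat.of (Metric.closedBall (0 : Eucl p) r)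
  | L + 1 =>
    letI : MeasurableSpace (IDMTop p r L) := borel (IDMTop p r L)
    haveI : BorelSpace (IDMTop p r L) := ⟨rfl⟩
    TopCat.of (IDMTop p r L × SubProbMeasure (IDMTop p r L))

/-- The space `ℋ^L` of iterated degree measures (IDMs) of order `L`. -/
def IDM (p : ℕ) (r : ℝ) (L : ℕ) : Type := IDMTop p r L

instance (p : ℕ) (r : ℝ) (L : ℕ) : TopologicalSpace (IDM p r L) :=
  inferInstanceAs (TopologicalSpace (IDMTop p r L))

instance (p : ℕ) (r : ℝ) (L : ℕ) : MeasurableSpace (IDM p r L) := borel (IDM p r L)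

instance (p : ℕ) (r : ℝ) (L : ℕ) : BorelSpace (IDM p r L) := ⟨rfl⟩

/-- The identification of `ℋ^0` with the closed ball of `ℝ^p`. -/
def IDM.zeroHomeo (p : ℕ) (r : ℝ) : IDM p r 0 ≃ₜ Metric.closedBall (0 : Eucl p) r :=
  Homeomorph.refl _

/-- The identification of `ℋ^{L+1}` with `ℋ^L × ℳ_{≤ 1}(ℋ^L)`. -/
def IDM.succHomeo (p : ℕ) (r : ℝ) (L : ℕ) :
    IDM p r (L + 1) ≃ₜ IDM p r L × SubProbMeasure (IDM p r L) :=
  Homeomorph.refl _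

/-- The node attribute, a point of `ℝ^p`, that an IDM of order `0` consists of. -/
def IDM.attr {p : ℕ} {r : ℝ} (τ : IDM p r 0) : Eucl p := (IDM.zeroHomeo p r τ : Eucl p)

/-- The canonical projection `p_{L+1,L} : ℋ^{L+1} → ℋ^L` which drops the last entry. -/
def IDM.trunc {p : ℕ} {r : ℝ} {L : ℕ} (τ : IDM p r (L + 1)) : IDM p r L :=
  (IDM.succHomeo p r L τ).1

/-- The canonical projection `p_{L+1} : ℋ^{L+1} → ℳ^{L+1}` onto the last entry, a measure of
total mass at most one on `ℋ^L`. -/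
def IDM.last {p : ℕ} {r : ℝ} {L : ℕ} (τ : IDM p r (L + 1)) : SubProbMeasure (IDM p r L) :=
  (IDM.succHomeo p r L τ).2

/-- `𝒫(ℋ^L)`: the distributions of iterated degree measures (DIDMs) of order `L`, that is, the
Borel probability measures on `ℋ^L`, with the weak* topology. -/
abbrev DIDM (p : ℕ) (r : ℝ) (L : ℕ) : Type := ProbabilityMeasure (IDM p r L)

/-- `MPNN p L n`: the `L`-layer MPNN models with input feature dimension `p` and last hidden
feature dimension `d_L = n` (and arbitrary other hidden dimensions). Such a model is a finite
sequence of Lipschitz continuous functions: `φ^(0) : ℝ^p → ℝ^{d_0}`, then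
`φ^(t) : ℝ^{2 d_{t-1}} → ℝ^{d_t}` for `1 ≤ t ≤ L`, where `ℝ^{2m}` is written as the
Euclidean (`ℓ²`) product `ℝ^m × ℝ^m`. -/
inductive MPNN (p : ℕ) : ℕ → ℕ → Type
  | init {n : ℕ} (φ : Eucl p → Eucl n) (hφ : ∃ K, LipschitzWith K φ) : MPNN p 0 n
  | layer {L m n : ℕ} (prev : MPNN p L m) (φ : WithLp 2 (Eucl m × Eucl m) → Eucl n)
      (hφ : ∃ K, LipschitzWith K φ) : MPNN p (L + 1) n

/-- The hidden representation `𝔥(φ)^(L) : ℋ^L → ℝ^{d_L}` of an `L`-layer MPNN model on IDMs. -/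
def MPNN.hidden {p : ℕ} {r : ℝ} : {L n : ℕ} → MPNN p L n → IDM p r L → Eucl n
  | _, _, .init φ _, τ => φ τ.attr
  | _, _, .layer prev φ _, τ =>
    φ (WithLp.toLp 2 (prev.hidden τ.trunc, ∫ σ : IDM p r _, prev.hidden σ ∂(τ.last.1 : Measure (IDM p r _))))

/-- The output `ℌ(φ, ψ, ν)` of an `L`-layer MPNN model with readout `ψ` on a DIDM `ν`. -/
def MPNN.output {p : ℕ} {r : ℝ} {L n d : ℕ} (φ : MPNN p L n) (ψ : Eucl n → Eucl d)
    (ν : DIDM p r L) : Eucl d :=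
  ψ (∫ τ, φ.hidden τ ∂(ν : Measure (IDM p r L)))

end

/-! ### Integration of continuous functions over a compact space -/

section Integration

variable {X : Type*} [TopologicalSpace X] [CompactSpace X] [MeasurableSpace X] [BorelSpace X]

/-! Each `IDM p r L` is compact and metrizable, and every hidden representation is continuous on it.
Weak* convergence therefore passes through the integral and the continuous readout. Conversely,
against probability measures it suffices to test convergence on a sup-norm dense set of continuous
functions, and the scalar features of MPNN models are such a set (`MPNN.dense_scalarFeatures`). They
form a lattice, because models run in parallel (`MPNN.exists_hidden_eq_prod`) and min and max are
Lipschitz. The lattice Stone–Weierstrass theorem applies once they separate points; the algebra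
version would not fit, as products of Lipschitz functions need not be Lipschitz. Separation and
density feed each other by induction on the order (`MPNN.exists_hidden_ne`): density at order `L`
separates measures on `IDM p r L`, hence points of order `L + 1`. -/

theorem integrable_of_continuous_compactSpace {E : Type*} [NormedAddCommGroup E]
    (μ : Measure X) [IsFiniteMeasure μ] {f : X → E} (hf : Continuous f) : Integrable f μ :=
  hf.integrable_of_hasCompactSupport (HasCompactSupport.of_compactSpace f)

theorem continuous_integral_eucl {n : ℕ} {f : X → Eucl n} (hf : Continuous f) :
    Continuous fun μ : FiniteMeasure X => ∫ x, f x ∂(μ : Measure X) := by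
  refine ((PiLp.continuous_toLp 2 fun _ : Fin n => ℝ).comp (continuous_pi fun k => ?_ :
    Continuous fun (μ : FiniteMeasure X) k => ∫ x, f x k ∂(μ : Measure X))).congr ?_
  · exact FiniteMeasure.continuous_integral_continuousMap
      (⟨fun x => f x k, by fun_prop⟩ : C(X, ℝ))
  · intro μ
    ext k
    exact (EuclideanSpace.proj (𝕜 := ℝ) k).integral_comp_comm
      (integrable_of_continuous_compactSpace (μ : Measure X) hf)

theorem abs_integral_sub_integral_le (μ : Measure X) [IsFiniteMeasure μ] (f g : C(X, ℝ)) :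
    |∫ x, f x ∂μ - ∫ x, g x ∂μ| ≤ dist f g * μ.real Set.univ := by
  rw [← integral_sub (integrable_of_continuous_compactSpace μ f.continuous)
    (integrable_of_continuous_compactSpace μ g.continuous)]
  have h (x : X) : ‖f x - g x‖ ≤ dist f g := by
    rw [← dist_eq_norm]
    exact ContinuousMap.dist_apply_le_dist x
  exact norm_integral_le_of_norm_le_const (Eventually.of_forall h)

theorem continuous_integral_continuousMap_left (μ : Measure X) [IsFiniteMeasure μ] :
    Continuous fun f : C(X, ℝ) => ∫ x, f x ∂μ :=
  (LipschitzWith.of_dist_le_mul (K := (μ Set.univ).toNNReal) fun f g => by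
    rw [mul_comm]
    exact abs_integral_sub_integral_le μ f g).continuous

theorem measure_eq_of_dense_integral_eq [HasOuterApproxClosed X] {D : Set C(X, ℝ)} (hD : Dense D)
    {μ ν : Measure X} [IsFiniteMeasure μ] [IsFiniteMeasure ν]
    (h : ∀ f ∈ D, ∫ x, f x ∂μ = ∫ x, f x ∂ν) : μ = ν := by
  have key := Continuous.ext_on hD (continuous_integral_continuousMap_left μ)
    (continuous_integral_continuousMap_left ν) h
  exact ext_of_forall_integral_eq_of_IsFiniteMeasure fun f => congrFun key f.toContinuousMap

/-- An `ε / 3` argument: total mass one makes the approximation error uniform over all the measures.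
-/
theorem probabilityMeasure_tendsto_of_dense {D : Set C(X, ℝ)} (hD : Dense D)
    {ι : Type*} {l : Filter ι} {μs : ι → ProbabilityMeasure X} {μ : ProbabilityMeasure X}
    (h : ∀ f ∈ D, Tendsto (fun i => ∫ x, f x ∂(μs i : Measure X)) l
      (𝓝 (∫ x, f x ∂(μ : Measure X)))) :
    Tendsto μs l (𝓝 μ) := by
  rw [ProbabilityMeasure.tendsto_iff_forall_integral_tendsto]
  intro f
  rw [Metric.tendsto_nhds]
  intro ε hε
  obtain ⟨g, hg, hfg⟩ := Metric.dense_iff.1 hD f.toContinuousMap (ε / 3) (by positivity)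
  have close (P : ProbabilityMeasure X) :
      |∫ x, f x ∂(P : Measure X) - ∫ x, g x ∂(P : Measure X)| < ε / 3 := by
    have := abs_integral_sub_integral_le (P : Measure X) f.toContinuousMap g
    rw [probReal_univ, mul_one, dist_comm] at this
    exact this.trans_lt hg
  filter_upwards [Metric.tendsto_nhds.1 (h g hfg) (ε / 3) (by positivity)] with i hi
  have h1 := abs_lt.1 (close (μs i))
  have h2 := abs_lt.1 (close μ)
  rw [Real.dist_eq, abs_lt] at hi ⊢
  constructor <;> linarith [h1.1, h1.2, h2.1, h2.2, hi.1, hi.2]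

end Integration

/-! ### Topology of the space of iterated degree measures -/

section Topology

variable {X : Type} [TopologicalSpace X] [CompactSpace X] [TopologicalSpace.MetrizableSpace X]
  [MeasurableSpace X] [BorelSpace X]

instance SubProbMeasure.instCompactSpace : CompactSpace (SubProbMeasure X) :=
  isCompact_iff_compactSpace.1 (isCompact_setOfPred_finiteMeasure_le_of_compactSpace X 1)

/-- Integrals against a dense sequence of `C(X, ℝ)` give a continuous injection into `ℕ → ℝ`;
compactness of the source makes it an embedding. -/
instance SubProbMeasure.instMetrizableSpace :
    TopologicalSpace.MetrizableSpace (SubProbMeasure X) := by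
  let := TopologicalSpace.metrizableSpaceMetric X
  let F : SubProbMeasure X → ℕ → ℝ := fun μ k =>
    ∫ x, TopologicalSpace.denseSeq C(X, ℝ) k x ∂(μ.1 : Measure X)
  have hF : Continuous F := continuous_pi fun k =>
    (FiniteMeasure.continuous_integral_continuousMap
      (TopologicalSpace.denseSeq C(X, ℝ) k)).comp continuous_subtype_val
  have inj : Function.Injective F := fun μ ν h => by
    have hμν : (μ.1 : Measure X) = ν.1 := measure_eq_of_dense_integral_eq
      (TopologicalSpace.denseRange_denseSeq C(X, ℝ)) (by
        rintro _ ⟨k, rfl⟩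
        exact congrFun h k)
    exact Subtype.ext (Subtype.ext hμν)
  exact (hF.isClosedEmbedding inj).isEmbedding.metrizableSpace

theorem IDM.compactSpace_and_metrizableSpace (p : ℕ) (r : ℝ) (L : ℕ) :
    CompactSpace (IDM p r L) ∧ TopologicalSpace.MetrizableSpace (IDM p r L) := by
  induction L with
  | zero =>
    have : CompactSpace (Metric.closedBall (0 : Eucl p) r) :=
      isCompact_iff_compactSpace.1 (isCompact_closedBall _ _)
    exact ⟨(IDM.zeroHomeo p r).symm.compactSpace, (IDM.zeroHomeo p r).isEmbedding.metrizableSpace⟩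
  | succ L ih =>
    obtain ⟨_, _⟩ := ih
    exact ⟨(IDM.succHomeo p r L).symm.compactSpace,
      (IDM.succHomeo p r L).isEmbedding.metrizableSpace⟩

instance (p : ℕ) (r : ℝ) (L : ℕ) : CompactSpace (IDM p r L) :=
  (IDM.compactSpace_and_metrizableSpace p r L).1

instance (p : ℕ) (r : ℝ) (L : ℕ) : TopologicalSpace.MetrizableSpace (IDM p r L) :=
  (IDM.compactSpace_and_metrizableSpace p r L).2

theorem IDM.continuous_attr {p : ℕ} {r : ℝ} : Continuous (IDM.attr (p := p) (r := r)) :=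
  continuous_subtype_val.comp (IDM.zeroHomeo p r).continuous

theorem IDM.continuous_trunc {p : ℕ} {r : ℝ} {L : ℕ} :
    Continuous (IDM.trunc (p := p) (r := r) (L := L)) :=
  continuous_fst.comp (IDM.succHomeo p r L).continuous

theorem IDM.continuous_last {p : ℕ} {r : ℝ} {L : ℕ} :
    Continuous (IDM.last (p := p) (r := r) (L := L)) :=
  continuous_snd.comp (IDM.succHomeo p r L).continuous

end Topology

/-! ### Lipschitz maps between Euclidean spaces -/

section Lipschitz

variable {α β γ : Type*} [PseudoEMetricSpace α] [PseudoEMetricSpace β] [PseudoEMetricSpace γ]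

theorem exists_lipschitzWith_comp {f : β → γ} {g : α → β} (hf : ∃ K, LipschitzWith K f)
    (hg : ∃ K, LipschitzWith K g) : ∃ K, LipschitzWith K fun x => f (g x) :=
  let ⟨_, hf⟩ := hf
  let ⟨_, hg⟩ := hg
  ⟨_, hf.comp hg⟩

theorem exists_lipschitzWith_toLp_prodMk {f : α → β} {g : α → γ} (hf : ∃ K, LipschitzWith K f)
    (hg : ∃ K, LipschitzWith K g) :
    ∃ K, LipschitzWith K fun x => WithLp.toLp 2 (f x, g x) :=
  let ⟨_, hf⟩ := hf
  let ⟨_, hg⟩ := hg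
  ⟨_, (WithLp.prod_lipschitzWith_toLp 2 β γ).comp (hf.prodMk hg)⟩

theorem exists_lipschitzWith_toLp_const {f : α → ℝ} (n : ℕ) (hf : ∃ K, LipschitzWith K f) :
    ∃ K, LipschitzWith K fun x => (WithLp.toLp 2 fun _ => f x : Eucl n) :=
  let ⟨_, hf⟩ := hf
  ⟨_, (PiLp.lipschitzWith_toLp 2 fun _ : Fin n => ℝ).comp
    (g := fun x _ => f x) (fun x y => edist_pi_le_iff.2 fun _ => hf x y)⟩

theorem ContinuousLinearMap.exists_lipschitzWith {E F : Type*} [NormedAddCommGroup E]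
    [NormedSpace ℝ E] [NormedAddCommGroup F] [NormedSpace ℝ F] (f : E →L[ℝ] F) :
    ∃ K, LipschitzWith K f :=
  ⟨_, f.lipschitz⟩

theorem exists_lipschitzWith_coord {n : ℕ} (k : Fin n) :
    ∃ K, LipschitzWith K fun x : Eucl n => x k :=
  (EuclideanSpace.proj (𝕜 := ℝ) k).exists_lipschitzWith

theorem exists_lipschitzWith_fst {m n : ℕ} :
    ∃ K, LipschitzWith K fun x : WithLp 2 (Eucl m × Eucl n) => x.fst :=
  (WithLp.fstL 2 ℝ (Eucl m) (Eucl n)).exists_lipschitzWith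

theorem exists_lipschitzWith_snd {m n : ℕ} :
    ∃ K, LipschitzWith K fun x : WithLp 2 (Eucl m × Eucl n) => x.snd :=
  (WithLp.sndL 2 ℝ (Eucl m) (Eucl n)).exists_lipschitzWith

/-- The linear identification of `ℝ^m × ℝ^n` with `ℝ^{m+n}`. -/
noncomputable def euclProdEquiv (m n : ℕ) : WithLp 2 (Eucl m × Eucl n) ≃L[ℝ] Eucl (m + n) :=
  (WithLp.prodContinuousLinearEquiv 2 ℝ (Eucl m) (Eucl n)).trans
    (ContinuousLinearEquiv.ofFinrankEq (by
      rw [Module.finrank_prod, finrank_euclideanSpace_fin, finrank_euclideanSpace_fin,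
        finrank_euclideanSpace_fin]))

end Lipschitz

/-! ### Features computed by MPNN models -/

namespace MPNN

variable {p : ℕ} {r : ℝ} {L : ℕ}

theorem continuous_hidden {n : ℕ} (φ : MPNN p L n) :
    Continuous (φ.hidden : IDM p r L → Eucl n) := by
  induction φ with
  | init φ hφ =>
    obtain ⟨K, hK⟩ := hφ
    exact hK.continuous.comp IDM.continuous_attr
  | layer prev φ hφ ih =>
    obtain ⟨K, hK⟩ := hφ
    refine hK.continuous.comp ((WithLp.prod_continuous_toLp 2 _ _).comp
      ((ih.comp IDM.continuous_trunc).prodMk ?_))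
    exact (continuous_integral_eucl ih).comp (continuous_subtype_val.comp IDM.continuous_last)

theorem integral_euclProdEquiv {X : Type*} [MeasurableSpace X] {μ : Measure X} {m n : ℕ}
    {f : X → Eucl m} {g : X → Eucl n} (hf : Integrable f μ) (hg : Integrable g μ) :
    ∫ x, euclProdEquiv m n (WithLp.toLp 2 (f x, g x)) ∂μ =
      euclProdEquiv m n (WithLp.toLp 2 (∫ x, f x ∂μ, ∫ x, g x ∂μ)) := by
  rw [← integral_pair hf hg]
  exact ((WithLp.prodContinuousLinearEquiv 2 ℝ (Eucl m) (Eucl n)).symm.trans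
    (euclProdEquiv m n)).toContinuousLinearMap.integral_comp_comm (hf.prodMk hg)

/-- Running two models in parallel and applying a Lipschitz map to both outputs is a model. -/
theorem exists_hidden_eq_prod {m n k : ℕ} (φ₁ : MPNN p L m) (φ₂ : MPNN p L n)
    {g : WithLp 2 (Eucl m × Eucl n) → Eucl k} (hg : ∃ K, LipschitzWith K g) :
    ∃ φ : MPNN p L k, ∀ τ : IDM p r L,
      φ.hidden τ = g (WithLp.toLp 2 (φ₁.hidden τ, φ₂.hidden τ)) := by
  induction φ₁ generalizing n k with
  | init f₁ hf₁ =>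
    cases φ₂ with
    | init f₂ hf₂ =>
      exact ⟨.init _ (exists_lipschitzWith_comp hg (exists_lipschitzWith_toLp_prodMk hf₁ hf₂)),
        fun τ => rfl⟩
  | @layer L m₁ m prev₁ f₁ hf₁ ih =>
    cases φ₂ with
    | @layer _ m₂ _ prev₂ f₂ hf₂ =>
      -- The joint model stores both previous features in one vector. The packing is linear, so it
      -- commutes with the aggregation integral, and the next layer can unpack both arguments.
      obtain ⟨prev, hprev⟩ := ih prev₂ (euclProdEquiv m₁ m₂).toContinuousLinearMap.exists_lipschitzWith
      let e := (euclProdEquiv m₁ m₂).symm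
      have he : ∃ K, LipschitzWith K e := e.toContinuousLinearMap.exists_lipschitzWith
      have h₁ := exists_lipschitzWith_comp exists_lipschitzWith_fst he
      have h₂ := exists_lipschitzWith_comp exists_lipschitzWith_snd he
      have hfst := exists_lipschitzWith_fst (m := m₁ + m₂) (n := m₁ + m₂)
      have hsnd := exists_lipschitzWith_snd (m := m₁ + m₂) (n := m₁ + m₂)
      refine ⟨.layer prev _ (exists_lipschitzWith_comp hg (exists_lipschitzWith_toLp_prodMk
        (exists_lipschitzWith_comp hf₁ (exists_lipschitzWith_toLp_prodMk
          (exists_lipschitzWith_comp h₁ hfst) (exists_lipschitzWith_comp h₁ hsnd)))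
        (exists_lipschitzWith_comp hf₂ (exists_lipschitzWith_toLp_prodMk
          (exists_lipschitzWith_comp h₂ hfst) (exists_lipschitzWith_comp h₂ hsnd))))),
        fun τ => ?_⟩
      have hint : ∫ σ : IDM p r L, prev.hidden σ ∂(τ.last.1 : Measure (IDM p r L)) =
          euclProdEquiv m₁ m₂ (WithLp.toLp 2
            (∫ σ : IDM p r L, prev₁.hidden σ ∂(τ.last.1 : Measure (IDM p r L)),
              ∫ σ : IDM p r L, prev₂.hidden σ ∂(τ.last.1 : Measure (IDM p r L)))) := by
        rw [← integral_euclProdEquiv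
          (integrable_of_continuous_compactSpace _ prev₁.continuous_hidden)
          (integrable_of_continuous_compactSpace _ prev₂.continuous_hidden)]
        exact integral_congr_ae (Eventually.of_forall hprev)
      simp only [hidden, hint]
      simp [hprev, e]

theorem exists_hidden_eq_comp {n k : ℕ} (φ : MPNN p L n) {g : Eucl n → Eucl k}
    (hg : ∃ K, LipschitzWith K g) :
    ∃ φ' : MPNN p L k, ∀ τ : IDM p r L, φ'.hidden τ = g (φ.hidden τ) :=
  exists_hidden_eq_prod φ φ (exists_lipschitzWith_comp hg exists_lipschitzWith_fst)

theorem exists_hidden_eq_const (p L : ℕ) (r : ℝ) {n : ℕ} (c : Eucl n) :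
    ∃ φ : MPNN p L n, ∀ τ : IDM p r L, φ.hidden τ = c := by
  cases L with
  | zero => exact ⟨.init _ ⟨0, LipschitzWith.const c⟩, fun τ => rfl⟩
  | succ L =>
    -- Any model of order `L` would do, since the last layer ignores its input.
    obtain ⟨φ, -⟩ := exists_hidden_eq_const p L r (0 : Eucl 0)
    exact ⟨.layer φ _ ⟨0, LipschitzWith.const c⟩, fun τ => rfl⟩

/-- The continuous scalar functions on `ℋ^L` that are features of an MPNN model. -/
def scalarFeatures (p : ℕ) (r : ℝ) (L : ℕ) : Set C(IDM p r L, ℝ) :=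
  {f | ∃ φ : MPNN p L 1, ∀ τ, f τ = φ.hidden τ 0}

theorem mem_scalarFeatures_of_prod {n : ℕ} (φ : MPNN p L n) {m : ℕ} (φ' : MPNN p L m)
    {g : WithLp 2 (Eucl n × Eucl m) → ℝ} (hg : ∃ K, LipschitzWith K g) (f : C(IDM p r L, ℝ))
    (hf : ∀ τ, f τ = g (WithLp.toLp 2 (φ.hidden τ, φ'.hidden τ))) :
    f ∈ scalarFeatures p r L := by
  obtain ⟨φ'', h⟩ := exists_hidden_eq_prod (r := r) φ φ' (exists_lipschitzWith_toLp_const 1 hg)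
  exact ⟨φ'', fun τ => by rw [h, hf]⟩

theorem inf_mem_scalarFeatures {f g : C(IDM p r L, ℝ)} (hf : f ∈ scalarFeatures p r L)
    (hg : g ∈ scalarFeatures p r L) : f ⊓ g ∈ scalarFeatures p r L := by
  obtain ⟨φ, hφ⟩ := hf
  obtain ⟨φ', hφ'⟩ := hg
  obtain ⟨_, h₁⟩ := exists_lipschitzWith_comp (exists_lipschitzWith_coord 0)
    (exists_lipschitzWith_fst (m := 1) (n := 1))
  obtain ⟨_, h₂⟩ := exists_lipschitzWith_comp (exists_lipschitzWith_coord 0)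
    (exists_lipschitzWith_snd (m := 1) (n := 1))
  exact mem_scalarFeatures_of_prod φ φ' ⟨_, h₁.min h₂⟩ _ fun τ => by simp [hφ, hφ']

theorem sup_mem_scalarFeatures {f g : C(IDM p r L, ℝ)} (hf : f ∈ scalarFeatures p r L)
    (hg : g ∈ scalarFeatures p r L) : f ⊔ g ∈ scalarFeatures p r L := by
  obtain ⟨φ, hφ⟩ := hf
  obtain ⟨φ', hφ'⟩ := hg
  obtain ⟨_, h₁⟩ := exists_lipschitzWith_comp (exists_lipschitzWith_coord 0)
    (exists_lipschitzWith_fst (m := 1) (n := 1))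
  obtain ⟨_, h₂⟩ := exists_lipschitzWith_comp (exists_lipschitzWith_coord 0)
    (exists_lipschitzWith_snd (m := 1) (n := 1))
  exact mem_scalarFeatures_of_prod φ φ' ⟨_, h₁.max h₂⟩ _ fun τ => by simp [hφ, hφ']

theorem exists_scalarFeature_eq_affine (φ : MPNN p L 1) (a b : ℝ) :
    ∃ f ∈ scalarFeatures p r L, ∀ τ, f τ = a * φ.hidden τ 0 + b := by
  obtain ⟨_, h⟩ := exists_lipschitzWith_coord (0 : Fin 1)
  have hg : ∃ K, LipschitzWith K fun x : Eucl 1 => a * x 0 + b :=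
    exists_lipschitzWith_comp (f := fun t : ℝ => a * t + b)
      ⟨‖a‖₊, LipschitzWith.of_dist_le_mul fun x y => by
        simp [Real.dist_eq, ← mul_sub, abs_mul]⟩ ⟨_, h⟩
  obtain ⟨φ', hφ'⟩ := exists_hidden_eq_comp (r := r) φ (exists_lipschitzWith_toLp_const 1 hg)
  have hc : Continuous fun τ : IDM p r L => φ'.hidden τ 0 :=
    (EuclideanSpace.proj (𝕜 := ℝ) (0 : Fin 1)).continuous.comp φ'.continuous_hidden
  exact ⟨⟨_, hc⟩, ⟨φ', fun _ => rfl⟩, fun τ => by simp [hφ']⟩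

/-- Lattice Stone–Weierstrass asks for a feature with prescribed values at two points; an affine
rescaling of a separating feature provides it. -/
theorem dense_scalarFeatures_of_separates
    (sep : ∀ x y : IDM p r L, x ≠ y → ∃ φ : MPNN p L 1, φ.hidden x 0 ≠ φ.hidden y 0) :
    Dense (scalarFeatures p r L) := by
  have hconst (c : ℝ) : ∃ f ∈ scalarFeatures p r L, ∀ τ, f τ = c := by
    obtain ⟨φ, -⟩ := exists_hidden_eq_const p L r (0 : Eucl 1)
    obtain ⟨f, hf, h⟩ := exists_scalarFeature_eq_affine (r := r) φ 0 c
    exact ⟨f, hf, fun τ => by simp [h]⟩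
  rw [dense_iff_closure_eq]
  refine ContinuousMap.sublattice_closure_eq_top _ ?_ (fun f hf g hg => inf_mem_scalarFeatures hf hg)
    (fun f hf g hg => sup_mem_scalarFeatures hf hg) fun v x y => ?_
  · obtain ⟨f, hf, -⟩ := hconst 0
    exact ⟨f, hf⟩
  · by_cases hxy : x = y
    · subst hxy
      obtain ⟨f, hf, h⟩ := hconst (v x)
      exact ⟨f, hf, h x, h x⟩
    · obtain ⟨φ, hφ⟩ := sep x y hxy
      have hne := sub_ne_zero.2 hφ
      obtain ⟨f, hf, h⟩ := exists_scalarFeature_eq_affine (r := r) φ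
        ((v x - v y) / (φ.hidden x 0 - φ.hidden y 0))
        (v x - (v x - v y) / (φ.hidden x 0 - φ.hidden y 0) * φ.hidden x 0)
      refine ⟨f, hf, by rw [h]; ring, ?_⟩
      rw [h]
      field_simp
      ring

theorem integral_hidden_apply {n : ℕ} (φ : MPNN p L n) (μ : Measure (IDM p r L))
    [IsFiniteMeasure μ] (k : Fin n) :
    (∫ τ, φ.hidden τ ∂μ) k = ∫ τ, φ.hidden τ k ∂μ :=
  ((EuclideanSpace.proj (𝕜 := ℝ) k).integral_comp_comm
    (integrable_of_continuous_compactSpace μ φ.continuous_hidden)).symm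

theorem exists_hidden_ne (x y : IDM p r L) (hxy : x ≠ y) :
    ∃ φ : MPNN p L 1, φ.hidden x 0 ≠ φ.hidden y 0 := by
  induction L with
  | zero =>
    have hattr : x.attr ≠ y.attr := fun h =>
      hxy ((IDM.zeroHomeo p r).injective (Subtype.ext h))
    obtain ⟨k, hk⟩ : ∃ k, x.attr k ≠ y.attr k := by
      by_contra! h
      exact hattr (PiLp.ext h)
    exact ⟨.init _ (exists_lipschitzWith_toLp_const 1 (exists_lipschitzWith_coord k)), hk⟩
  | succ L ih =>
    -- Equal truncations force distinct last measures. By density at order `L` some feature has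
    -- different integrals against them, and a layer returning its second argument outputs these
    -- integrals. Otherwise a layer returning its first argument carries up a feature separating the
    -- truncations.
    by_cases htr : x.trunc = y.trunc
    · have hlast : (x.last.1 : Measure (IDM p r L)) ≠ y.last.1 := fun h =>
        hxy ((IDM.succHomeo p r L).injective (Prod.ext htr (Subtype.ext (Subtype.ext h))))
      obtain ⟨f, ⟨φ, hφ⟩, hf⟩ : ∃ f ∈ scalarFeatures p r L,
          ∫ σ, f σ ∂(x.last.1 : Measure (IDM p r L)) ≠
            ∫ σ, f σ ∂(y.last.1 : Measure (IDM p r L)) := by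
        by_contra! h
        exact hlast (measure_eq_of_dense_integral_eq (dense_scalarFeatures_of_separates ih) h)
      refine ⟨.layer φ _ exists_lipschitzWith_snd, ?_⟩
      change (∫ σ, φ.hidden σ ∂(x.last.1 : Measure (IDM p r L))) 0 ≠
        (∫ σ, φ.hidden σ ∂(y.last.1 : Measure (IDM p r L))) 0
      simpa only [integral_hidden_apply, ← hφ] using hf
    · obtain ⟨φ, hφ⟩ := ih _ _ htr
      exact ⟨.layer φ _ exists_lipschitzWith_fst, hφ⟩

theorem dense_scalarFeatures : Dense (scalarFeatures p r L) :=
  dense_scalarFeatures_of_separates exists_hidden_ne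

end MPNN

theorem mainTheorem9 (p : ℕ) (r : ℝ) (hr : 0 < r) (L d : ℕ) (hd : 0 < d)
    (ν : DIDM p r L) (νs : ℕ → DIDM p r L) :
    Tendsto νs atTop (𝓝 ν) ↔
      ∀ (n : ℕ) (φ : MPNN p L n) (ψ : Eucl n → Eucl d), (∃ K, LipschitzWith K ψ) →
        Tendsto (fun i => φ.output ψ (νs i)) atTop (𝓝 (φ.output ψ ν)) := by
  constructor
  · rintro h n φ ψ ⟨K, hψ⟩
    exact ((hψ.continuous.comp ((continuous_integral_eucl φ.continuous_hidden).comp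
      ProbabilityMeasure.toFiniteMeasure_continuous)).tendsto ν).comp h
  · intro h
    refine probabilityMeasure_tendsto_of_dense MPNN.dense_scalarFeatures ?_
    rintro f ⟨φ, hφ⟩
    -- The readout copies the scalar feature's integral into all `d` coordinates; `hd` supplies a
    -- coordinate from which to read it back.
    have key := ((EuclideanSpace.proj (𝕜 := ℝ) (⟨0, hd⟩ : Fin d)).continuous.tendsto _).comp
      (h 1 φ _ (exists_lipschitzWith_toLp_const d (exists_lipschitzWith_coord 0)))
    have hout (P : DIDM p r L) : ∫ τ, f τ ∂(P : Measure (IDM p r L)) =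
        (∫ τ, φ.hidden τ ∂(P : Measure (IDM p r L))) 0 := by
      simp only [hφ, MPNN.integral_hidden_apply]
    simp only [hout]
    exact key
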